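/- Theorem 2.2. Let $X\to B$ be a morphism of fine and saturated (fs) log schemes (with log structures on the small étale site). For a morphism $Z\to X$ of fs log schemes let $\mathrm{Sec}_{X/B}(Z/X)$ be the following category over the category $\mathfrak{LogSch}$ of fs log schemes. An object over $S$ is a morphism $S\to B$, a base change $X_S=X\times_B S$ in $\mathfrak{LogSch}$, and a morphism $X_S\to Z$ over $X$; equivalently, a section $X_S\to Z_S$ of $Z_S=Z\times_B S\to X_S$. An arrow over $S\to S'$ is a cartesian diagram formed by a morphism $X_S\to X_{S'}$ over the $B$-morphism $S\to S'$, compatible with the maps to $X$ and with the maps to $Z$. A morphism $Z\to Z'$ over $X$ induces a functor $\mathrm{Sec}_{X/B}(Z/X)\to\mathrm{Sec}_{X/B}(Z'/X)$ over $\mathfrak{LogSch}$ by composition. Let $\Delta=(Z_\alpha,\ \pi_{\alpha\beta}:Z_\alpha\to Z_\beta)$ be a (for example finite) diagram of fs log schemes over $X$, indexed by a category with a final object whose value in the diagram is $X$ itself (up to isomorphism over $X$). Assume that $Z$, with projections $Z\to Z_\alpha$, is a limit of $\Delta$ in the category of fs log schemes. Then $$\mathrm{Sec}_{X/B}(Z/X)=\varprojlim_\alpha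 \mathrm{Sec}_{X/B}(Z_\alpha/X),$$ that is, $\mathrm{Sec}_{X/B}(Z/X)$ with the functors induced by the projections is the limit in the 2-category of categories over $\mathfrak{LogSch}$: for every category $\mathcal T$ over $\mathfrak{LogSch}$, composition with these functors is an equivalence from the category of functors $\mathcal T\to\mathrm{Sec}_{X/B}(Z/X)$ over $\mathfrak{LogSch}$ to the category of families of functors $\mathcal T\to\mathrm{Sec}_{X/B}(Z_\alpha/X)$ over $\mathfrak{LogSch}$ with compatible isomorphisms over $\mathfrak{LogSch}$ along all arrows of $\Delta$. Moreover, for every fs log scheme $Z$ over $X$: given $S\to B$ and base changes $X_S$ and $Z_S$ along it, the fiber of $\mathrm{Sec}_{X/B}(Z/X)$ over $S\to B$ is equivalent to the discrete category of sections of $Z_S\to X_S$; every arrow of $\mathrm{Sec}_{X/B}(Z/X)$ is (strongly) cartesian over $\mathfrak{LogSch}$; and an object over $S\to B$ has a cartesian pullback along $S'\to S$ if and only if the fiber product $X\times_B S'$ exists in $\mathfrak{LogSch}$. -/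

import Mathlib

open CategoryTheory Limits Opposite AlgebraicGeometry

universe u v w v₁ u₁ v₂ u₂ v₃ u₃ v₄ u₄

/-! ## Fine and saturated log schemes -/

section LogSchemes

/-- The étale structure sheaf of a scheme `X`, as a presheaf of multiplicative monoids on the
small étale site: `U ↦ (Γ(U, 𝒪_U), ·)`. -/
noncomputable def etaleStructureMonoid (X : Scheme.{u}) : X.Etaleᵒᵖ ⥤ CommMonCat.{u} where
  obj U := CommMonCat.of Γ(U.unop.left, ⊤)
  map g := CommMonCat.ofHom (g.unop.left.appTop.hom : _ →* _)
  map_id U := by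
    ext x
    change (𝟙 U.unop.left : U.unop.left ⟶ U.unop.left).appTop.hom x = x
    simp
  map_comp {U V W} g h := by
    ext x
    change (h.unop.left ≫ g.unop.left).appTop.hom x = _
    rw [Scheme.Hom.comp_appTop]
    rfl

/-- A morphism in the small étale site of `X`, from a morphism of schemes over `X`. -/
def etaleHomMk {X : Scheme.{u}} {U V : X.Etale} (g : U.left ⟶ V.left) (h : g ≫ V.hom = U.hom) :
    U ⟶ V := MorphismProperty.Over.homMk g h trivial

theorem etale_w {X : Scheme.{u}} {U V : X.Etale} (g : U ⟶ V) : g.left ≫ V.hom = U.hom :=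
  CategoryTheory.Over.w g.toCommaMorphism

/-- A log structure on a scheme `X`: a sheaf of commutative monoids `M` on the small étale site of
`X`, with a homomorphism `α : M → 𝒪_X` to the multiplicative monoid of `𝒪_X` that restricts to an
isomorphism `α⁻¹(𝒪_X^×) ≅ 𝒪_X^×`. -/
structure LogStructure (X : Scheme.{u}) where
  /-- the sheaf of monoids -/
  M : X.Etaleᵒᵖ ⥤ CommMonCat.{u}
  isSheaf : Presheaf.IsSheaf (Scheme.smallEtaleTopology X) M
  /-- the structure map to the functions -/
  α : M ⟶ etaleStructureMonoid X
  existsUnique_of_isUnit : ∀ (U : X.Etale) (s : Γ(U.left, ⊤)), IsUnit s →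
    ∃! m : M.obj (op U), (α.app (op U)).hom m = s

/-- A commutative monoid is fine and saturated: it is finitely generated, it is integral (that is,
cancellative), and it is saturated in its group of fractions: if `(a / b) ^ n` lies in `P` for some
`n ≥ 1`, then `a / b` lies in `P`. -/
structure IsFsMonoid (P : Type u) [CommMonoid P] : Prop where
  fg : Monoid.FG P
  integral : IsCancelMul P
  saturated : ∀ (a b : P) (n : ℕ), 1 ≤ n → b ^ n ∣ a ^ n → b ∣ a

namespace LogStructure

variable {X : Scheme.{u}} (L : LogStructure X)

/-- Restriction of sections of the sheaf of monoids. -/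
def res {U V : X.Etale} (g : V ⟶ U) : L.M.obj (op U) →* L.M.obj (op V) := (L.M.map g.op).hom

/-- `β : P → M(U)` is a chart over the étale `X`-scheme `U`: the induced map from the log structure
associated to `P → M(U) → 𝒪(U)` to `M|_U` is an isomorphism.

The associated log structure is the sheafification of the presheaf of push-outs sending `V → U` to
`P ⊕_{F(V)} M(V)^×`, where `F(V) ⊆ P` is the set of elements that become units on `V`, and
`M(V)^× = 𝒪(V)^×`. Its elements are classes of pairs `(p, e)`, where `(p, e) ∼ (p', e')` if and only
if there are `q, q'` in `F(V)` with `p q = p' q'` and `e β(q)⁻¹ = e' β(q')⁻¹`. So the map to `M|_U`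
is an isomorphism if and only if `(p, e) ↦ β(p) e` is locally surjective and locally injective for
the étale topology. -/
structure IsChart (U : X.Etale) {P : Type u} [CommMonoid P] (β : P →* L.M.obj (op U)) : Prop where
  locally_surjective : ∀ (V : X.Etale) (g : V ⟶ U) (m : L.M.obj (op V)) (y : V.left),
    ∃ (W : X.Etale) (h : W ⟶ V), y ∈ Set.range h.left ∧
      ∃ (p : P) (e : L.M.obj (op W)), IsUnit e ∧ L.res h m = L.res (h ≫ g) (β p) * e
  locally_injective : ∀ (V : X.Etale) (g : V ⟶ U) (p p' : P) (e e' : L.M.obj (op V)),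
    IsUnit e → IsUnit e' → L.res g (β p) * e = L.res g (β p') * e' → ∀ y : V.left,
    ∃ (W : X.Etale) (h : W ⟶ V), y ∈ Set.range h.left ∧
      ∃ q q' : P, IsUnit (L.res (h ≫ g) (β q)) ∧ IsUnit (L.res (h ≫ g) (β q')) ∧
        p * q = p' * q' ∧ L.res h e * L.res (h ≫ g) (β q') = L.res h e' * L.res (h ≫ g) (β q)

/-- A log structure is fine and saturated if étale locally it has a chart by a fine and saturated
monoid. -/
def IsFs : Prop :=
  ∀ x : X, ∃ U : X.Etale, x ∈ Set.range U.hom ∧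
    ∃ (P : Type u) (_ : CommMonoid P) (β : P →* L.M.obj (op U)), IsFsMonoid P ∧ L.IsChart U β

end LogStructure

/-- A log scheme: a scheme with a log structure. -/
structure LogScheme where
  /-- the underlying scheme -/
  scheme : Scheme.{u}
  /-- the log structure -/
  log : LogStructure scheme

namespace LogScheme

/-- A morphism of log schemes `X → Y`: a morphism `f` of the underlying schemes with a homomorphism
`M_Y → f_* M_X` of sheaves of monoids compatible with the maps to `𝒪_Y → f_* 𝒪_X`.

The homomorphism `M_Y → f_* M_X` (equivalently `f⁻¹ M_Y → M_X`) is given by its components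
`M_Y(V) → M_X(U)` at all `g : U → V` over `f`, where `U` is étale over `X` and `V` is étale over
`Y`; these are natural in `U` and `V`, so that they are determined by the ones for
`U = X ×_Y V`. -/
structure Hom (X Y : LogScheme.{u}) where
  /-- the morphism of the underlying schemes -/
  base : X.scheme ⟶ Y.scheme
  /-- the homomorphism of sheaves of monoids -/
  flat : ∀ (U : X.scheme.Etale) (V : Y.scheme.Etale) (g : U.left ⟶ V.left),
    g ≫ V.hom = U.hom ≫ base → (Y.log.M.obj (op V) →* X.log.M.obj (op U))
  flat_res_left : ∀ (U U' : X.scheme.Etale) (V : Y.scheme.Etale) (h : U' ⟶ U)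
    (g : U.left ⟶ V.left) (g' : U'.left ⟶ V.left) (hg : g ≫ V.hom = U.hom ≫ base)
    (hg' : g' ≫ V.hom = U'.hom ≫ base), h.left ≫ g = g' →
    ∀ m, X.log.res h (flat U V g hg m) = flat U' V g' hg' m
  flat_res_right : ∀ (U : X.scheme.Etale) (V V' : Y.scheme.Etale) (h : V' ⟶ V)
    (g : U.left ⟶ V.left) (g' : U.left ⟶ V'.left) (hg : g ≫ V.hom = U.hom ≫ base)
    (hg' : g' ≫ V'.hom = U.hom ≫ base), g' ≫ h.left = g →
    ∀ m, flat U V' g' hg' (Y.log.res h m) = flat U V g hg m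
  flat_α : ∀ (U : X.scheme.Etale) (V : Y.scheme.Etale) (g : U.left ⟶ V.left)
    (hg : g ≫ V.hom = U.hom ≫ base) (m : Y.log.M.obj (op V)),
    (X.log.α.app (op U)).hom (flat U V g hg m) = g.appTop.hom ((Y.log.α.app (op V)).hom m)

namespace Hom

variable {X Y Z T : LogScheme.{u}}

theorem ext' {f g : Hom X Y} (hb : f.base = g.base)
    (h : ∀ U V k hk hk' m, f.flat U V k hk m = g.flat U V k hk' m) : f = g := by
  obtain ⟨b, φ, _, _, _⟩ := f
  obtain ⟨b', φ', _, _, _⟩ := g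
  obtain rfl : b = b' := hb
  obtain rfl : φ = φ' := by
    funext U V k hk
    exact MonoidHom.ext (h U V k hk hk)
  rfl

/-- The étale `Y`-scheme `V ×_Z Y`, for `V` étale over `Z` and `f : Y → Z`. -/
noncomputable def pull {Y Z : Scheme.{u}} (f : Y ⟶ Z) (V : Z.Etale) : Y.Etale :=
  Scheme.Etale.mk (pullback.snd V.hom f)

/-- The projection `V ×_Z Y → V`. -/
noncomputable def pullFst {Y Z : Scheme.{u}} (f : Y ⟶ Z) (V : Z.Etale) :
    (pull f V).left ⟶ V.left := pullback.fst V.hom f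

theorem pullFst_comp {Y Z : Scheme.{u}} (f : Y ⟶ Z) (V : Z.Etale) :
    pullFst f V ≫ V.hom = (pull f V).hom ≫ f := pullback.condition

/-- The map `U → V ×_Z Y` with the given components. -/
noncomputable def pullLift {Y Z : Scheme.{u}} (f : Y ⟶ Z) (V : Z.Etale) {U : Scheme.{u}}
    (a : U ⟶ V.left) (b : U ⟶ Y) (h : a ≫ V.hom = b ≫ f) : U ⟶ (pull f V).left :=
  pullback.lift a b h

theorem pullLift_fst {Y Z : Scheme.{u}} (f : Y ⟶ Z) (V : Z.Etale) {U : Scheme.{u}}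
    (a : U ⟶ V.left) (b : U ⟶ Y) (h : a ≫ V.hom = b ≫ f) :
    pullLift f V a b h ≫ pullFst f V = a := pullback.lift_fst _ _ _

theorem pullLift_hom {Y Z : Scheme.{u}} (f : Y ⟶ Z) (V : Z.Etale) {U : Scheme.{u}}
    (a : U ⟶ V.left) (b : U ⟶ Y) (h : a ≫ V.hom = b ≫ f) :
    pullLift f V a b h ≫ (pull f V).hom = b := pullback.lift_snd _ _ _

theorem pull_hom_ext {Y Z : Scheme.{u}} (f : Y ⟶ Z) (V : Z.Etale) {U : Scheme.{u}}
    {a b : U ⟶ (pull f V).left} (h₁ : a ≫ pullFst f V = b ≫ pullFst f V)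
    (h₂ : a ≫ (pull f V).hom = b ≫ (pull f V).hom) : a = b := pullback.hom_ext h₁ h₂

/-- The identity morphism of a log scheme. -/
def id (X : LogScheme.{u}) : Hom X X where
  base := 𝟙 _
  flat U V g hg := X.log.res (etaleHomMk g (by simpa using hg))
  flat_res_left U U' V h g g' hg hg' e m := by
    subst e
    change (X.log.M.map _ ≫ X.log.M.map _).hom m = (X.log.M.map _).hom m
    rw [← X.log.M.map_comp]
    rfl
  flat_res_right U V V' h g g' hg hg' e m := by
    subst e
    change (X.log.M.map _ ≫ X.log.M.map _).hom m = (X.log.M.map _).hom m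
    rw [← X.log.M.map_comp]
    rfl
  flat_α U V g hg m := by
    exact congr($(X.log.α.naturality
      (etaleHomMk g (by simpa using hg) : U ⟶ V).op).hom m)

/-- The composition of two morphisms of log schemes: for `U → W` over the composite, the map
`M_Z(W) → M_X(U)` is the composite `M_Z(W) → M_Y(Y ×_Z W) → M_X(U)`. -/
noncomputable def comp (f : Hom X Y) (g : Hom Y Z) : Hom X Z where
  base := f.base ≫ g.base
  flat U W k hk :=
    (f.flat U (pull g.base W) (pullLift g.base W k (U.hom ≫ f.base) (by simpa using hk))
      (pullLift_hom _ _ _ _ _)).comp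
    (g.flat (pull g.base W) W (pullFst g.base W) (pullFst_comp _ _))
  flat_res_left U U' W h k k' hk hk' e m := by
    subst e
    refine f.flat_res_left _ _ _ h _ _ _ _ ?_ _
    apply pull_hom_ext
    · simp [pullLift_fst]
    · simp only [Category.assoc, pullLift_hom]
      rw [← Category.assoc, etale_w]
  flat_res_right U W W' h k k' hk hk' e m := by
    subst e
    simp only [MonoidHom.comp_apply]
    have h1 : pullFst g.base W' ≫ h.left ≫ W.hom = (pull g.base W').hom ≫ g.base := by
      rw [← pullFst_comp, etale_w]
    let r : pull g.base W' ⟶ pull g.base W := etaleHomMk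
      (pullLift g.base W (pullFst g.base W' ≫ h.left) (pull g.base W').hom (by simpa using h1))
      (pullLift_hom _ _ _ _ _)
    have hr : r.left ≫ pullFst g.base W = pullFst g.base W' ≫ h.left := pullLift_fst _ _ _ _ _
    have hr' : r.left ≫ (pull g.base W).hom = (pull g.base W').hom := pullLift_hom _ _ _ _ _
    rw [g.flat_res_right _ W W' h (pullFst g.base W' ≫ h.left) _
      (by simpa using h1) _ rfl,
      ← g.flat_res_left _ _ _ r _ _ (pullFst_comp _ _) (by simpa using h1) hr]
    refine f.flat_res_right _ _ _ r _ _ _ _ ?_ _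
    apply pull_hom_ext
    · simp [hr, pullLift_fst, reassoc_of% pullLift_fst]
    · simp [hr', pullLift_hom]
  flat_α U W k hk m := by
    simp only [MonoidHom.comp_apply]
    rw [f.flat_α, g.flat_α]
    have : k = pullLift g.base W k (U.hom ≫ f.base) (by simpa using hk) ≫ pullFst g.base W :=
      (pullLift_fst _ _ _ _ _).symm
    conv_rhs => rw [this, Scheme.Hom.comp_appTop]
    rfl

/-- The composite may be computed through any étale `Y`-scheme `V` between `U` and `W`. -/
theorem comp_flat (f : Hom X Y) (g : Hom Y Z) (U : X.scheme.Etale) (V : Y.scheme.Etale)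
    (W : Z.scheme.Etale) (a : U.left ⟶ V.left) (b : V.left ⟶ W.left)
    (ha : a ≫ V.hom = U.hom ≫ f.base) (hb : b ≫ W.hom = V.hom ≫ g.base)
    (k : U.left ⟶ W.left) (hk : k ≫ W.hom = U.hom ≫ f.base ≫ g.base) (e : a ≫ b = k)
    (m : Z.log.M.obj (op W)) :
    (comp f g).flat U W k hk m = f.flat U V a ha (g.flat V W b hb m) := by
  subst e
  let r : V ⟶ pull g.base W := etaleHomMk
    (pullLift g.base W b V.hom hb) (pullLift_hom _ _ _ _ _)
  have hr : r.left ≫ pullFst g.base W = b := pullLift_fst _ _ _ _ _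
  have hr' : r.left ≫ (pull g.base W).hom = V.hom := pullLift_hom _ _ _ _ _
  rw [← g.flat_res_left _ _ _ r (pullFst g.base W) b (pullFst_comp _ _) hb hr]
  refine (f.flat_res_right _ _ _ r _ _ _ _ ?_ _).symm
  apply pull_hom_ext
  · simp [hr, pullLift_fst]
  · simp [hr', pullLift_hom, ha]

end Hom

noncomputable instance : Category LogScheme.{u} where
  Hom := Hom
  id := Hom.id
  comp := Hom.comp
  id_comp {X Y} f := by
    refine Hom.ext' (Category.id_comp _) fun U V k hk hk' m ↦ ?_
    rw [Hom.comp_flat (Hom.id X) f U U V (𝟙 _) k (by simp [Hom.id]) hk' k hk (by simp)]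
    exact congr($(X.log.M.map_id (op U)).hom _)
  comp_id {X Y} f := by
    refine Hom.ext' (Category.comp_id _) fun U V k hk hk' m ↦ ?_
    rw [Hom.comp_flat f (Hom.id Y) U V V k (𝟙 _) hk' (by simp [Hom.id]) k hk (by simp)]
    exact congr(f.flat U V k hk' ($(Y.log.M.map_id (op V)).hom m))
  assoc {X Y Z T} f g h := by
    refine Hom.ext' (Category.assoc _ _ _) fun U V k hk hk' m ↦ ?_
    let V₂ := Hom.pull h.base V
    let V₁ := Hom.pull g.base V₂
    have e₂ : k ≫ V.hom = (U.hom ≫ f.base ≫ g.base) ≫ h.base := by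
      simpa [Hom.comp] using hk
    let a₂ : U.left ⟶ V₂.left := Hom.pullLift h.base V k _ e₂
    have h₂ : a₂ ≫ V₂.hom = U.hom ≫ f.base ≫ g.base := Hom.pullLift_hom _ _ _ _ _
    have h₂' : a₂ ≫ Hom.pullFst h.base V = k := Hom.pullLift_fst _ _ _ _ _
    let a₁ : U.left ⟶ V₁.left := Hom.pullLift g.base V₂ a₂ (U.hom ≫ f.base) (by simpa using h₂)
    have h₁ : a₁ ≫ V₁.hom = U.hom ≫ f.base := Hom.pullLift_hom _ _ _ _ _
    have h₁' : a₁ ≫ Hom.pullFst g.base V₂ = a₂ := Hom.pullLift_fst _ _ _ _ _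
    have e₁ : (Hom.pullFst g.base V₂ ≫ Hom.pullFst h.base V) ≫ V.hom =
        V₁.hom ≫ g.base ≫ h.base := by
      rw [Category.assoc, Hom.pullFst_comp, ← Category.assoc, Hom.pullFst_comp, Category.assoc]
    refine (Hom.comp_flat (f.comp g) h U V₂ V a₂ (Hom.pullFst h.base V) h₂ (Hom.pullFst_comp _ _)
      k hk h₂' m).trans ?_
    refine (Hom.comp_flat f g U V₁ V₂ a₁ (Hom.pullFst g.base V₂) h₁ (Hom.pullFst_comp _ _)
      a₂ h₂ h₁' _).trans ?_
    refine Eq.symm ((Hom.comp_flat f (g.comp h) U V₁ V a₁ _ h₁ e₁ k hk'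
      (by rw [reassoc_of% h₁', h₂']) m).trans ?_)
    exact congrArg _ (Hom.comp_flat g h V₁ V₂ V (Hom.pullFst g.base V₂) (Hom.pullFst h.base V)
      (Hom.pullFst_comp _ _) (Hom.pullFst_comp _ _) _ e₁ rfl m)

end LogScheme

/-- The category of fine and saturated log schemes, a full subcategory of the category of log
schemes. -/
abbrev FsLogScheme : Type (u + 1) :=
  ObjectProperty.FullSubcategory fun X : LogScheme.{u} ↦ X.log.IsFs

end LogSchemes
/-! ## Limits in the 2-category of categories over a base category -/

section TwoLimits

open scoped CategoryTheory.BasedFunctor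
open CategoryTheory.Functor

variable {J : Type w} [Category.{v} J] {𝒮 : Type u₁} [Category.{v₁} 𝒮]

/-- The component `H (G x) → K x` of a natural transformation `H ∘ G → K` of functors over `𝒮`. -/
def compApp {𝒯 : BasedCategory.{v₃, u₃} 𝒮} {𝒳 : BasedCategory.{v₂, u₂} 𝒮}
    {𝒴 : BasedCategory.{v₄, u₄} 𝒮} {G : 𝒯 ⥤ᵇ 𝒳} {H : 𝒳 ⥤ᵇ 𝒴} {K : 𝒯 ⥤ᵇ 𝒴}
    (m : BasedFunctor.comp G H ⟶ K) (x : 𝒯.obj) : H.obj (G.obj x) ⟶ K.obj x := m.app x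

/-- A (pseudo-)cone with vertex `𝒯` over a diagram `F` of categories over `𝒮`: functors
`π j : 𝒯 → F j` over `𝒮` together with isomorphisms `F a ∘ π i ≅ π j` over `𝒮` for all arrows
`a : i → j`, compatible with identities and composition of arrows. -/
structure PseudoCone (F : J ⥤ BasedCategory.{v₂, u₂} 𝒮) (𝒯 : BasedCategory.{v₃, u₃} 𝒮) where
  /-- the projections -/
  π (j : J) : 𝒯 ⥤ᵇ F.obj j
  /-- the compatibility isomorphisms -/
  θ {i j : J} (a : i ⟶ j) : (BasedFunctor.comp (π i) (F.map a) : 𝒯 ⥤ᵇ F.obj j) ≅ π j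
  θ_id (j : J) (x : 𝒯.obj) : compApp (θ (𝟙 j)).hom x = eqToHom (by rw [F.map_id]; rfl)
  θ_comp {i j k : J} (a : i ⟶ j) (b : j ⟶ k) (x : 𝒯.obj) :
    compApp (θ (a ≫ b)).hom x =
      eqToHom (by rw [F.map_comp]; rfl) ≫ (F.map b).map (compApp (θ a).hom x) ≫ compApp (θ b).hom x

namespace PseudoCone

variable {F : J ⥤ BasedCategory.{v₂, u₂} 𝒮} {𝒯 : BasedCategory.{v₃, u₃} 𝒮}

/-- A morphism of pseudo-cones with the same vertex (a modification): natural transformations over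
`𝒮` between the projections, compatible with the compatibility isomorphisms. -/
@[ext]
structure Hom (P Q : PseudoCone F 𝒯) where
  /-- the components -/
  app (j : J) : P.π j ⟶ Q.π j
  comm {i j : J} (a : i ⟶ j) (x : 𝒯.obj) :
    (F.map a).map ((app i).app x) ≫ compApp (Q.θ a).hom x = compApp (P.θ a).hom x ≫ (app j).app x

/-- The category of pseudo-cones over `F` with vertex `𝒯`. -/
instance : Category (PseudoCone F 𝒯) where
  Hom := Hom
  id P :=
    { app j := 𝟙 (P.π j)
      comm a x := by
        refine (congr($((F.map a).map_id _) ≫ _)).trans ?_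
        exact (Category.id_comp _).trans (Category.comp_id _).symm }
  comp {P Q R} m n :=
    { app j := m.app j ≫ n.app j
      comm {i j} a x := by
        change (F.map a).map ((m.app i).app x ≫ (n.app i).app x) ≫ _ =
          _ ≫ (m.app j).app x ≫ (n.app j).app x
        rw [Functor.map_comp, Category.assoc, n.comm, ← Category.assoc, m.comm, Category.assoc] }
  id_comp m := by ext j : 2; exact Category.id_comp _
  comp_id m := by ext j : 2; exact Category.comp_id _
  assoc m n p := by ext j : 2; exact Category.assoc _ _ _

/-- For a pseudo-cone with vertex `ℒ`, the functor from functors `𝒯 → ℒ` over `𝒮` to pseudo-cones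
with vertex `𝒯`, by composition with the projections. -/
def comparison {ℒ : BasedCategory.{v₄, u₄} 𝒮} (P : PseudoCone F ℒ)
    (𝒯 : BasedCategory.{v₃, u₃} 𝒮) : (𝒯 ⥤ᵇ ℒ) ⥤ PseudoCone F 𝒯 where
  obj G :=
    { π j := BasedFunctor.comp G (P.π j)
      θ a :=
        { hom := BasedCategory.whiskerLeft G (P.θ a).hom
          inv := BasedCategory.whiskerLeft G (P.θ a).inv
          hom_inv_id := by
            ext x
            exact congr(($((P.θ a).hom_inv_id)).app (G.obj x))
          inv_hom_id := by
            ext x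
            exact congr(($((P.θ a).inv_hom_id)).app (G.obj x)) }
      θ_id j x := P.θ_id j (G.obj x)
      θ_comp a b x := P.θ_comp a b (G.obj x) }
  map {G G'} m :=
    { app j := BasedCategory.whiskerRight m (P.π j)
      comm {i j} a x := ((P.θ a).hom.naturality (m.app x)) }
  map_id G := by
    refine Hom.ext ?_
    funext j
    ext x
    exact (P.π j).map_id _
  map_comp m n := by
    refine Hom.ext ?_
    funext j
    ext x
    exact (P.π j).map_comp _ _

/-- A pseudo-cone with vertex `ℒ` is a limit cone in the 2-category of categories over `𝒮` if for
every category `𝒯` over `𝒮` composition with it is an equivalence from the category of functors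
`𝒯 → ℒ` over `𝒮` to the category of pseudo-cones with vertex `𝒯`. -/
def IsTwoLimit {ℒ : BasedCategory.{v₄, u₄} 𝒮} (P : PseudoCone F ℒ) : Prop :=
  ∀ 𝒯 : BasedCategory.{v₃, u₃} 𝒮, (P.comparison 𝒯).IsEquivalence

theorem eqToHom_app {𝒯 : BasedCategory.{v₃, u₃} 𝒮} {ℒ : BasedCategory.{v₄, u₄} 𝒮} {G H : 𝒯 ⥤ᵇ ℒ}
    (h : G = H) (x : 𝒯.obj) :
    (eqToHom h : G ⟶ H).app x = eqToHom (by rw [h]) := by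
  subst h; rfl

theorem eqToHom_map_eqToHom {𝒯 : BasedCategory.{v₃, u₃} 𝒮} {ℒ : BasedCategory.{v₄, u₄} 𝒮}
    (G : 𝒯 ⥤ᵇ ℒ) {x y : 𝒯.obj} {y' z : ℒ.obj} (h₁ : y' = G.obj x) (h : x = y) (h₂ : G.obj y = z) :
    eqToHom (h₁.trans ((congrArg G.obj h).trans h₂)) =
      eqToHom h₁ ≫ G.map (eqToHom h) ≫ eqToHom h₂ := by
  subst h h₂ h₁; simp

/-- A cone that commutes strictly, regarded as a pseudo-cone with identities as compatibility
isomorphisms. -/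
def ofCone (c : Cone F) : PseudoCone F c.pt where
  π j := c.π.app j
  θ a := eqToIso (c.w a)
  θ_id j x := eqToHom_app (c.w (𝟙 j)) x
  θ_comp a b x := by
    have h {i j : J} (a : i ⟶ j) (x : c.pt.obj) : compApp (eqToIso (c.w a)).hom x =
        eqToHom (congr(($(c.w a)).obj x)) := eqToHom_app (c.w a) x
    rw [h, h, h]
    exact eqToHom_map_eqToHom (F.map b) _ _ _

end PseudoCone

end TwoLimits

/-! ## The category of sections -/

section Sections

open CategoryTheory.Functor

variable {C : Type u₁} [Category.{v₁} C] {X B : C}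

/-- An object of the category `Sec_{X/B}(Z/X)` over `S`: a morphism `S → B`, a base change
`X_S = X ×_B S` of `X`, and a morphism `s : X_S → Z` over `X` (equivalently, a section of
`Z_S = Z ×_B S → X_S`). -/
structure SecObj (f : X ⟶ B) (Z : Over X) where
  /-- the base -/
  S : C
  /-- the structure map of the base -/
  b : S ⟶ B
  /-- the base change of `X` -/
  XS : C
  /-- the projection to `X` -/
  toX : XS ⟶ X
  /-- the projection to the base -/
  toS : XS ⟶ S
  isPullback : IsPullback toX toS f b
  /-- the section -/
  s : XS ⟶ Z.left
  w : s ≫ Z.hom = toX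

/-- An arrow of `Sec_{X/B}(Z/X)` over `S → S'`: the map `S → S'` is over `B`, and it comes with a
cartesian diagram of `X_S → X_S'` over `S → S'`, compatible with the maps to `X` and with the
sections. -/
@[ext]
structure SecHom {f : X ⟶ B} {Z : Over X} (x y : SecObj f Z) where
  /-- the map on the bases -/
  base : x.S ⟶ y.S
  /-- the map on the base changes of `X` -/
  tot : x.XS ⟶ y.XS
  base_b : base ≫ y.b = x.b
  tot_toX : tot ≫ y.toX = x.toX
  isPullback : IsPullback tot x.toS y.toS base
  tot_s : tot ≫ y.s = x.s

instance (f : X ⟶ B) (Z : Over X) : Category (SecObj f Z) where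
  Hom := SecHom
  id x :=
    { base := 𝟙 _
      tot := 𝟙 _
      base_b := Category.id_comp _
      tot_toX := Category.id_comp _
      isPullback := IsPullback.of_horiz_isIso ⟨by simp⟩
      tot_s := Category.id_comp _ }
  comp m n :=
    { base := m.base ≫ n.base
      tot := m.tot ≫ n.tot
      base_b := by rw [Category.assoc, n.base_b, m.base_b]
      tot_toX := by rw [Category.assoc, n.tot_toX, m.tot_toX]
      isPullback := m.isPullback.paste_horiz n.isPullback
      tot_s := by rw [Category.assoc, n.tot_s, m.tot_s] }
  id_comp m := SecHom.ext (Category.id_comp _) (Category.id_comp _)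
  comp_id m := SecHom.ext (Category.comp_id _) (Category.comp_id _)
  assoc m n p := SecHom.ext (Category.assoc _ _ _) (Category.assoc _ _ _)

/-- The functor from `Sec_{X/B}(Z/X)` to the category of objects over `B` that sends a section over
`S → B` to `S → B`. -/
def secToOver (f : X ⟶ B) (Z : Over X) : SecObj f Z ⥤ Over B where
  obj x := Over.mk x.b
  map m := Over.homMk m.base m.base_b

/-- The category `Sec_{X/B}(Z/X)` over the base category, by the functor that sends a section over
`S → B` to `S`. -/
abbrev secBased (f : X ⟶ B) (Z : Over X) : BasedCategory.{v₁, max u₁ v₁} C where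
  obj := SecObj f Z
  category := inferInstance
  p := { obj x := x.S, map m := m.base }

/-- Composition of sections with a morphism `Z → Z'` over `X`. -/
def secMap (f : X ⟶ B) {Z Z' : Over X} (g : Z ⟶ Z') :
    BasedFunctor (secBased f Z) (secBased f Z') where
  obj x :=
    { S := x.S
      b := x.b
      XS := x.XS
      toX := x.toX
      toS := x.toS
      isPullback := x.isPullback
      s := x.s ≫ g.left
      w := by rw [Category.assoc, Over.w, x.w] }
  map m :=
    { base := m.base
      tot := m.tot
      base_b := m.base_b
      tot_toX := m.tot_toX
      isPullback := m.isPullback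
      tot_s := (Category.assoc _ _ _).symm.trans congr($(m.tot_s) ≫ g.left) }
  map_id _ := rfl
  map_comp _ _ := rfl
  w := rfl

theorem SecObj.ext' {f : X ⟶ B} {Z : Over X} {x : SecObj f Z} {s : x.XS ⟶ Z.left}
    (h : x.s = s) : x = { x with s := s, w := h ▸ x.w } := by
  subst h; rfl

theorem SecObj.eqToHom_base {f : X ⟶ B} {Z : Over X} {x y : SecObj f Z} (h : x = y) :
    (eqToHom h : x ⟶ y).base = eqToHom (by rw [h]) := by
  subst h; rfl

theorem SecObj.eqToHom_tot {f : X ⟶ B} {Z : Over X} {x y : SecObj f Z} (h : x = y) :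
    (eqToHom h : x ⟶ y).tot = eqToHom (by rw [h]) := by
  subst h; rfl

theorem basedFunctor_ext {f : X ⟶ B} {Z Z' : Over X}
    {G H : BasedFunctor (secBased f Z) (secBased f Z')}
    (h : ∀ x, G.obj x = H.obj x)
    (hb : ∀ {x y : SecObj f Z} (m : x ⟶ y),
      (G.map m).base ≫ eqToHom congr(($(h y)).S) = eqToHom congr(($(h x)).S) ≫ (H.map m).base)
    (ht : ∀ {x y : SecObj f Z} (m : x ⟶ y),
      (G.map m).tot ≫ eqToHom congr(($(h y)).XS) = eqToHom congr(($(h x)).XS) ≫ (H.map m).tot) :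
    G = H := by
  have : G.toFunctor = H.toFunctor := by
    refine CategoryTheory.Functor.ext h fun x y m ↦ ?_
    rw [← Category.assoc, ← IsIso.comp_inv_eq, inv_eqToHom]
    refine SecHom.ext ?_ ?_
    · refine Eq.trans ?_ ((hb m).trans ?_)
      · exact congr(_ ≫ $(SecObj.eqToHom_base _))
      · exact congr($((SecObj.eqToHom_base (h x)).symm) ≫ _)
    · refine Eq.trans ?_ ((ht m).trans ?_)
      · exact congr(_ ≫ $(SecObj.eqToHom_tot _))
      · exact congr($((SecObj.eqToHom_tot (h x)).symm) ≫ _)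
  cases G; cases H; subst this; rfl

/-- The functor `Z ↦ Sec_{X/B}(Z/X)` from objects over `X` to categories over the base category. -/
def secFunctor (f : X ⟶ B) : Over X ⥤ BasedCategory.{v₁, max u₁ v₁} C where
  obj Z := secBased f Z
  map g := secMap f g
  map_id _ := basedFunctor_ext
    (fun x ↦ (SecObj.ext' (x := x) (Category.comp_id _).symm).symm)
    (fun _ ↦ (Category.comp_id _).trans (Category.id_comp _).symm)
    (fun _ ↦ (Category.comp_id _).trans (Category.id_comp _).symm)
  map_comp g g' := basedFunctor_ext
    (fun x ↦ SecObj.ext' (x := (secMap f (g ≫ g')).obj x) (Category.assoc _ _ _).symm)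
    (fun _ ↦ (Category.comp_id _).trans (Category.id_comp _).symm)
    (fun _ ↦ (Category.comp_id _).trans (Category.id_comp _).symm)

/-- For base changes `X_S` of `X` and `Z_S` of `Z` along `b : S → B`, the functor from the discrete
category of sections of the canonical morphism `r : Z_S → X_S` to the fiber of `Sec_{X/B}(Z/X)` over
`S → B`; it sends a section `σ` to the composite `X_S → Z_S → Z`. -/
def sectionsToFiber (f : X ⟶ B) (Z : Over X) {S XS ZS : C} (b : S ⟶ B) {p : XS ⟶ X} {πS : XS ⟶ S}
    (h : IsPullback p πS f b) (q : ZS ⟶ Z.left) (r : ZS ⟶ XS) (hr : q ≫ Z.hom = r ≫ p) :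
    Discrete { σ : XS ⟶ ZS // σ ≫ r = 𝟙 XS } ⥤ Functor.Fiber (secToOver f Z) (Over.mk b) :=
  Discrete.functor fun σ ↦
    ⟨{ S := S
       b := b
       XS := XS
       toX := p
       toS := πS
       isPullback := h
       s := σ.1 ≫ q
       w := by rw [Category.assoc, hr, ← Category.assoc, σ.2, Category.id_comp] }, rfl⟩

end Sections

/-! Nothing here depends on log structures: the arguments work for a morphism `f : X ⟶ B` in any
category `C`.

The 2-limit. A family of functors to the categories of sections of the `D j` gives, for each `x`,
base changes of `X` and sections on them, one for every index, identified by coherent isomorphisms.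
Since `t` is terminal, everything can be transported canonically to the base change at `t` along the
isomorphisms of the arrows `j ⟶ t`; coherence makes the transported sections a cone over the diagram
underlying `D` (`sectionCone`). The limit turns this cone into one map to `c.pt.left`, which lies
over `X` because the leg at `t` does. This is `lift`, and `comparisonLiftIso` shows that it induces
the given family: essential surjectivity. For fullness, the compatibility isomorphisms of the strict
cone `c` are identities on base changes, so all components of a morphism of families have the same
underlying map (`compTot_eq`). That map respects the section of the limit because it respects every
leg (`compTot_s`). Faithfulness holds because an arrow over a given arrow of `C` is determined by
its map of base changes, visible already at `t`.

Fibers and pullbacks. Arrows are cartesian squares, so the universal property of these squares makes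
each arrow strongly cartesian, while an object over `S'` already contains a base change of `X` to
`S'`. In a fiber, a map of base changes is determined by its projections to `X` and `S`, and the
universal property of `Z_S` converts maps `X_S ⟶ Z` over `X` into sections. -/

section SectionsOfPullbacks

open scoped CategoryTheory.BasedFunctor
open CategoryTheory.Functor

variable {C : Type u₁} [Category.{v₁} C] {X B : C} {f : X ⟶ B}

/-! ### Arrows between sections and cartesian pullbacks. -/

namespace SecObj

variable {Z : Over X} {x y z : SecObj f Z}

/-- Two arrows over the same arrow of the base category are equal if they agree on the base
changes of `X`. -/
theorem hom_ext_of_isHomLift {R S : C} (φ : R ⟶ S) {m n : x ⟶ y}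
    (hm : (secBased f Z).p.IsHomLift φ m) (hn : (secBased f Z).p.IsHomLift φ n)
    (h : SecHom.tot m = SecHom.tot n) : m = n :=
  SecHom.ext ((IsHomLift.fac' (secBased f Z).p φ m).trans
    (IsHomLift.fac' (secBased f Z).p φ n).symm) h

theorem base_eq_of_isHomLift {φ : x.S ⟶ y.S} {m : x ⟶ y}
    (h : (secBased f Z).p.IsHomLift φ m) : SecHom.base m = φ :=
  (IsHomLift.eq_of_isHomLift (secBased f Z).p φ m).symm

theorem isHomLift_of_base_eq {φ : x.S ⟶ y.S} {m : x ⟶ y} (h : SecHom.base m = φ) :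
    (secBased f Z).p.IsHomLift φ m := by
  subst h
  exact IsHomLift.map (secBased f Z).p m

/-- A map on the base changes of `X` compatible with the projections and the sections gives an
arrow of sections. -/
def homMk (base : x.S ⟶ y.S) (tot : x.XS ⟶ y.XS) (hb : base ≫ y.b = x.b)
    (hX : tot ≫ y.toX = x.toX) (hS : tot ≫ y.toS = x.toS ≫ base) (hs : tot ≫ y.s = x.s) :
    x ⟶ y where
  base := base
  tot := tot
  base_b := hb
  tot_toX := hX
  -- Pasting law: the outer rectangle is the base change square of `x`, the right-hand square that
  -- of `y`.
  isPullback := IsPullback.of_right (by rw [hX, hb]; exact x.isPullback) hS y.isPullback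
  tot_s := hs

/-- Every arrow of `Sec_{X/B}(Z/X)` is strongly cartesian. -/
theorem isStronglyCartesian (m : x ⟶ y) :
    (secBased f Z).p.IsStronglyCartesian (SecHom.base m) m where
  toIsHomLift := isHomLift_of_base_eq rfl
  universal_property' {z} g n hn := by
    have hb : SecHom.base n = g ≫ SecHom.base m := base_eq_of_isHomLift hn
    have hp := m.isPullback
    have hw : SecHom.tot n ≫ y.toS = (z.toS ≫ g) ≫ SecHom.base m := by
      rw [n.isPullback.w, hb, Category.assoc]
    -- A map into the base change at the source of `m` is a pair of maps to `y.XS` and `x.S` that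
    -- agree over `y.S`. Both are prescribed here, which gives existence and uniqueness at once.
    refine ⟨homMk g (hp.lift (SecHom.tot n) (z.toS ≫ g) hw) ?_ ?_ (hp.lift_snd _ _ _) ?_,
      ⟨isHomLift_of_base_eq rfl, SecHom.ext hb.symm (hp.lift_fst _ _ _)⟩, ?_⟩
    · rw [← m.base_b, ← Category.assoc, ← hb]
      exact n.base_b
    · rw [← m.tot_toX, hp.lift_fst_assoc]
      exact n.tot_toX
    · rw [← m.tot_s, hp.lift_fst_assoc]
      exact n.tot_s
    · rintro χ ⟨hχ, e⟩
      have hχb : SecHom.base χ = g := base_eq_of_isHomLift hχ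
      refine SecHom.ext hχb (hp.hom_ext ?_ ?_)
      · exact (congrArg SecHom.tot e).trans (hp.lift_fst _ _ _).symm
      · refine χ.isPullback.w.trans (Eq.trans ?_ (hp.lift_snd _ _ _).symm)
        rw [hχb]

/-- A section over `S → B` has a cartesian pullback along `S' → S` if and only if the base change
of `X` along `S' → B` exists. -/
theorem hasPullback_iff_exists_isStronglyCartesian (x : SecObj f Z) {S' : C} (φ : S' ⟶ x.S) :
    HasPullback f (φ ≫ x.b) ↔
      ∃ (y : SecObj f Z) (m : y ⟶ x), (secBased f Z).p.IsStronglyCartesian φ m := by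
  constructor
  · intro _
    have h := IsPullback.of_hasPullback f (φ ≫ x.b)
    -- The section is pulled back along the canonical map `X_S' ⟶ X_S`.
    let l := x.isPullback.lift (pullback.fst f (φ ≫ x.b)) (pullback.snd f (φ ≫ x.b) ≫ φ)
      (by rw [h.w, Category.assoc])
    let y : SecObj f Z :=
      { S := S'
        b := φ ≫ x.b
        XS := pullback f (φ ≫ x.b)
        toX := pullback.fst _ _
        toS := pullback.snd _ _
        isPullback := h
        s := l ≫ x.s
        w := by rw [Category.assoc, x.w, x.isPullback.lift_fst] }
    let m : y ⟶ x := homMk φ l rfl (x.isPullback.lift_fst _ _ _) (x.isPullback.lift_snd _ _ _) rfl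
    exact ⟨y, m, isStronglyCartesian m⟩
  · rintro ⟨y, m, h⟩
    -- The object `y` carries a base change of `X`; what remains is to identify its structure map to
    -- `B` with `φ ≫ x.b`.
    obtain rfl : y.S = S' := IsHomLift.domain_eq (secBased f Z).p φ m
    obtain rfl : SecHom.base m = φ := base_eq_of_isHomLift h.toIsHomLift
    have e : SecHom.base m ≫ x.b = y.b := m.base_b
    rw [e]
    exact y.isPullback.hasPullback

/-! ### Fibers over a fixed morphism to the base. -/

/-- Objects of a fiber map to `R` only up to propositional equality, so lifting `𝟙 R` forces an
`eqToHom` on the bases. It becomes an identity once the two bases agree definitionally. -/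
theorem base_eq_eqToHom_of_isHomLift_secToOver (hS : x.S = y.S) {R : Over B} {m : x ⟶ y}
    (h : (secToOver f Z).IsHomLift (𝟙 R) m) : SecHom.base m = eqToHom hS := by
  refine (congrArg CommaMorphism.left (IsHomLift.fac' (secToOver f Z) (𝟙 R) m)).trans ?_
  simp
  rfl

theorem isHomLift_secToOver_of_base_eq_eqToHom {R : Over B} (hx : (secToOver f Z).obj x = R)
    (hy : (secToOver f Z).obj y = R) {m : x ⟶ y} (hS : x.S = y.S)
    (h : SecHom.base m = eqToHom hS) : (secToOver f Z).IsHomLift (𝟙 R) m := by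
  refine IsHomLift.of_fac' _ _ _ hx hy ?_
  ext
  refine h.trans ?_
  simp
  rfl

end SecObj

/-- Splits the equality that defines membership in a fiber into one of sources and one of structure
maps, so that each can be substituted. -/
theorem CategoryTheory.Over.exists_eq_of_mk_eq {B S S' : C} {b : S ⟶ B} {b' : S' ⟶ B}
    (h : Over.mk b = Over.mk b') : ∃ e : S = S', b = eqToHom e ≫ b' := by
  obtain rfl : S = S' := congrArg (fun A : Over B ↦ A.left) h
  refine ⟨rfl, ?_⟩
  have := Over.w (eqToHom h)
  simpa using this.symm

/-- The fiber of `Sec_{X/B}(Z/X)` over `S → B` is equivalent to the discrete category of sections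
of `Z_S → X_S`. -/
theorem isEquivalence_sectionsToFiber (Z : Over X) {S XS ZS : C} (b : S ⟶ B) {p : XS ⟶ X}
    {πX : XS ⟶ S} {q : ZS ⟶ Z.left} {πZ : ZS ⟶ S} {r : ZS ⟶ XS} (h : IsPullback p πX f b)
    (hZ : IsPullback q πZ (Z.hom ≫ f) b) (hp : q ≫ Z.hom = r ≫ p) (hr : r ≫ πX = πZ) :
    (sectionsToFiber f Z b h q r hp).IsEquivalence where
  faithful := ⟨fun _ ↦ Subsingleton.elim _ _⟩
  full := ⟨fun {σ τ} m ↦ by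
    have hb : SecHom.base m.1 = 𝟙 S := SecObj.base_eq_eqToHom_of_isHomLift_secToOver
      (x := ((sectionsToFiber f Z b h q r hp).obj σ).1)
      (y := ((sectionsToFiber f Z b h q r hp).obj τ).1) rfl m.2
    -- An endomorphism of `X_S` compatible with both projections is the identity.
    have ht : SecHom.tot m.1 = 𝟙 XS := by
      refine h.hom_ext (m.1.tot_toX.trans (Category.id_comp _).symm) ?_
      refine m.1.isPullback.w.trans ?_
      rw [hb]
      exact (Category.comp_id _).trans (Category.id_comp _).symm
    have hs : σ.as.1 ≫ q = τ.as.1 ≫ q := by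
      refine m.1.tot_s.symm.trans ?_
      rw [ht]
      exact Category.id_comp _
    -- A section of `r` has a fixed projection to `S`, so its composite to `Z` determines it.
    have e : σ = τ := by
      refine Discrete.ext (Subtype.ext (hZ.hom_ext hs ?_))
      rw [← hr, ← Category.assoc, ← Category.assoc, σ.as.2, τ.as.2]
    subst e
    refine ⟨𝟙 _, ?_⟩
    rw [CategoryTheory.Functor.map_id]
    exact Subtype.ext (SecHom.ext hb.symm ht.symm)⟩
  essSurj := ⟨by
    rintro ⟨⟨S', b', XS', p', πX', h', s, w⟩, hx⟩
    obtain ⟨rfl, e⟩ := Over.exists_eq_of_mk_eq hx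
    obtain rfl : b' = b := by simpa using e
    have e₁ := h.isoIsPullback_hom_fst _ _ h'
    have e₂ := h.isoIsPullback_hom_snd _ _ h'
    have e₁' := h.isoIsPullback_inv_fst _ _ h'
    have e₂' := h.isoIsPullback_inv_snd _ _ h'
    have ei := (h.isoIsPullback _ _ h').inv_hom_id
    set i := (h.isoIsPullback _ _ h').hom
    set k := (h.isoIsPullback _ _ h').inv
    -- The given section lives on another base change `XS'`; it is moved to `XS` along the canonical
    -- isomorphism `i` and paired with the projection to `S'` to land in `ZS`.
    have hl : (i ≫ s) ≫ Z.hom ≫ f = πX ≫ b' := by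
      rw [Category.assoc, reassoc_of% w, reassoc_of% e₁, h.w]
    let σ := hZ.lift (i ≫ s) πX hl
    have hσ : σ ≫ r = 𝟙 XS := by
      refine h.hom_ext ?_ ?_
      · rw [Category.assoc, ← hp, hZ.lift_fst_assoc, Category.assoc, w, e₁, Category.id_comp]
      · rw [Category.assoc, hr, hZ.lift_snd, Category.id_comp]
    let y := (sectionsToFiber f Z b' h q r hp).obj ⟨σ, hσ⟩
    let x : SecObj f Z := ⟨S', b', XS', p', πX', h', s, w⟩
    let m : y.1 ⟶ x := SecObj.homMk (𝟙 S') i (Category.id_comp _) e₁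
      (e₂.trans (Category.comp_id _).symm) (hZ.lift_fst _ _ _).symm
    let n : x ⟶ y.1 := SecObj.homMk (𝟙 S') k (Category.id_comp _) e₁'
      (e₂'.trans (Category.comp_id _).symm) (by
        refine (congrArg (k ≫ ·) (hZ.lift_fst _ _ _)).trans ?_
        exact (Category.assoc _ _ _).symm.trans (congr($ei ≫ s).trans (Category.id_comp _)))
    have hm : (secToOver f Z).IsHomLift (𝟙 (Over.mk b')) m :=
      SecObj.isHomLift_secToOver_of_base_eq_eqToHom (R := Over.mk b') rfl rfl rfl rfl
    have hn : (secToOver f Z).IsHomLift (𝟙 (Over.mk b')) n :=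
      SecObj.isHomLift_secToOver_of_base_eq_eqToHom (R := Over.mk b') rfl rfl rfl rfl
    refine ⟨⟨σ, hσ⟩, ⟨⟨⟨m, hm⟩, ⟨n, hn⟩, ?_, ?_⟩⟩⟩
    · exact Subtype.ext (SecHom.ext (Category.id_comp _) (h.isoIsPullback _ _ h').hom_inv_id)
    · exact Subtype.ext (SecHom.ext (Category.id_comp _) ei)⟩

end SectionsOfPullbacks

/-! ### Isomorphisms of pseudo-cones. -/

section PseudoConeIsos

open scoped CategoryTheory.BasedFunctor

variable {J : Type w} [Category.{v} J] {𝒮 : Type u₁} [Category.{v₁} 𝒮]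
  {F : J ⥤ BasedCategory.{v₂, u₂} 𝒮} {𝒯 : BasedCategory.{v₃, u₃} 𝒮}

theorem CategoryTheory.BasedFunctor.iso_hom_inv_id_app {𝒳 : BasedCategory.{v₂, u₂} 𝒮}
    {G H : 𝒯 ⥤ᵇ 𝒳} (e : G ≅ H) (x : 𝒯.obj) : e.hom.app x ≫ e.inv.app x = 𝟙 (G.obj x) :=
  congr(($(e.hom_inv_id)).app x)

theorem CategoryTheory.BasedFunctor.iso_inv_hom_id_app {𝒳 : BasedCategory.{v₂, u₂} 𝒮}
    {G H : 𝒯 ⥤ᵇ 𝒳} (e : G ≅ H) (x : 𝒯.obj) : e.inv.app x ≫ e.hom.app x = 𝟙 (H.obj x) :=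
  congr(($(e.inv_hom_id)).app x)

namespace PseudoCone

/-- Isomorphisms between the projections compatible with the compatibility isomorphisms give an
isomorphism of pseudo-cones. -/
def isoMk {P Q : PseudoCone F 𝒯} (e : ∀ j, P.π j ≅ Q.π j)
    (comm : ∀ {i j : J} (a : i ⟶ j) (x : 𝒯.obj),
      (F.map a).map ((e i).hom.app x) ≫ compApp (Q.θ a).hom x =
        compApp (P.θ a).hom x ≫ (e j).hom.app x) : P ≅ Q where
  hom :=
    { app j := (e j).hom
      comm := comm }
  inv :=
    { app j := (e j).inv
      comm {i j} a x := by
        -- Compatibility of the inverses is `comm` composed with the inverse at `i` on the left and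
        -- the inverse at `j` on the right.
        have h₁ : (F.map a).map ((e i).inv.app x) ≫ (F.map a).map ((e i).hom.app x) = 𝟙 _ := by
          rw [← Functor.map_comp, BasedFunctor.iso_inv_hom_id_app]
          exact (F.map a).map_id _
        have h₂ := BasedFunctor.iso_hom_inv_id_app (e j) x
        have h₃ := comm a x
        calc (F.map a).map ((e i).inv.app x) ≫ compApp (P.θ a).hom x
            = (F.map a).map ((e i).inv.app x) ≫ (compApp (P.θ a).hom x ≫ (e j).hom.app x) ≫
                (e j).inv.app x := by
              rw [Category.assoc, h₂]
              exact congr(_ ≫ $(Category.comp_id _)).symm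
          _ = compApp (Q.θ a).hom x ≫ (e j).inv.app x := by
              rw [← h₃, Category.assoc, reassoc_of% h₁] }
  hom_inv_id := Hom.ext (funext fun j ↦ (e j).hom_inv_id)
  inv_hom_id := Hom.ext (funext fun j ↦ (e j).inv_hom_id)

end PseudoCone

end PseudoConeIsos

/-! ### The data underlying a pseudo-cone of sections. -/

section TwoLimitOfSections

open scoped CategoryTheory.BasedFunctor
open CategoryTheory.Functor

variable {J : Type w} [Category.{v} J] {C : Type u₁} [Category.{v₁} C] {X B : C} {f : X ⟶ B}
  {D : J ⥤ Over X} {𝒯 : BasedCategory.{v₃, u₃} C}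

namespace PseudoCone

variable (Q : PseudoCone (D ⋙ secFunctor f) 𝒯)

/-- The value at `x` of the projection to the category of sections of `D j`. -/
def sec (j : J) (x : 𝒯.obj) : SecObj f (D.obj j) := (Q.π j).obj x

/-- The projections on arrows. -/
def secHom (j : J) {x y : 𝒯.obj} (m : x ⟶ y) : Q.sec j x ⟶ Q.sec j y := (Q.π j).map m

/-- The compatibility isomorphisms, as arrows between sections. -/
def compat {i j : J} (a : i ⟶ j) (x : 𝒯.obj) :
    (secMap f (D.map a)).obj (Q.sec i x) ⟶ Q.sec j x := compApp (Q.θ a).hom x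

/-- The inverses of the compatibility isomorphisms. -/
def compatInv {i j : J} (a : i ⟶ j) (x : 𝒯.obj) :
    Q.sec j x ⟶ (secMap f (D.map a)).obj (Q.sec i x) := (Q.θ a).inv.app x

theorem compat_compatInv {i j : J} (a : i ⟶ j) (x : 𝒯.obj) :
    Q.compat a x ≫ Q.compatInv a x = 𝟙 _ :=
  BasedFunctor.iso_hom_inv_id_app (Q.θ a) x

theorem compatInv_compat {i j : J} (a : i ⟶ j) (x : 𝒯.obj) :
    Q.compatInv a x ≫ Q.compat a x = 𝟙 _ :=
  BasedFunctor.iso_inv_hom_id_app (Q.θ a) x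

theorem compatInv_naturality {i j : J} (a : i ⟶ j) {x y : 𝒯.obj} (m : x ⟶ y) :
    Q.secHom j m ≫ Q.compatInv a y =
      Q.compatInv a x ≫ (secMap f (D.map a)).map (Q.secHom i m) :=
  (Q.θ a).inv.naturality m

/-- The `eqToHom` reflects that composing a section with `D.map a` and then `D.map b` equals
composing with the composite only up to associativity; the existential hides the proof of this
equality. -/
theorem compat_comp {i j k : J} (a : i ⟶ j) (b : j ⟶ k) (x : 𝒯.obj) :
    ∃ h, Q.compat (a ≫ b) x =
      eqToHom h ≫ (secMap f (D.map b)).map (Q.compat a x) ≫ Q.compat b x :=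
  ⟨_, Q.θ_comp a b x⟩

/-- The projections on arrows, on the bases. -/
def homBase (j : J) {x y : 𝒯.obj} (m : x ⟶ y) : (Q.sec j x).S ⟶ (Q.sec j y).S :=
  SecHom.base (Q.secHom j m)

/-- The projections on arrows, on the base changes of `X`. -/
def homTot (j : J) {x y : 𝒯.obj} (m : x ⟶ y) : (Q.sec j x).XS ⟶ (Q.sec j y).XS :=
  SecHom.tot (Q.secHom j m)

theorem homBase_id (j : J) (x : 𝒯.obj) : Q.homBase j (𝟙 x) = 𝟙 _ :=
  congrArg SecHom.base ((Q.π j).map_id x)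

theorem homTot_id (j : J) (x : 𝒯.obj) : Q.homTot j (𝟙 x) = 𝟙 _ :=
  congrArg SecHom.tot ((Q.π j).map_id x)

theorem homBase_comp (j : J) {x y z : 𝒯.obj} (m : x ⟶ y) (n : y ⟶ z) :
    Q.homBase j (m ≫ n) = Q.homBase j m ≫ Q.homBase j n :=
  congrArg SecHom.base ((Q.π j).map_comp m n)

theorem homTot_comp (j : J) {x y z : 𝒯.obj} (m : x ⟶ y) (n : y ⟶ z) :
    Q.homTot j (m ≫ n) = Q.homTot j m ≫ Q.homTot j n :=
  congrArg SecHom.tot ((Q.π j).map_comp m n)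

theorem homTot_s (j : J) {x y : 𝒯.obj} (m : x ⟶ y) :
    Q.homTot j m ≫ (Q.sec j y).s = (Q.sec j x).s :=
  (Q.secHom j m).tot_s

/-- The isomorphism between the base changes of `X` underlying a compatibility isomorphism. -/
def totIso {i j : J} (a : i ⟶ j) (x : 𝒯.obj) : (Q.sec i x).XS ≅ (Q.sec j x).XS where
  hom := SecHom.tot (Q.compat a x)
  inv := SecHom.tot (Q.compatInv a x)
  hom_inv_id := congrArg SecHom.tot (Q.compat_compatInv a x)
  inv_hom_id := congrArg SecHom.tot (Q.compatInv_compat a x)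

/-- The isomorphism between the bases underlying a compatibility isomorphism. -/
def baseIso {i j : J} (a : i ⟶ j) (x : 𝒯.obj) : (Q.sec i x).S ≅ (Q.sec j x).S where
  hom := SecHom.base (Q.compat a x)
  inv := SecHom.base (Q.compatInv a x)
  hom_inv_id := congrArg SecHom.base (Q.compat_compatInv a x)
  inv_hom_id := congrArg SecHom.base (Q.compatInv_compat a x)

/-- Reassociating a section leaves its base change untouched, so the `eqToHom` in the coherence law
becomes an identity and the cocycle condition is strict. -/
theorem totIso_hom_comp {i j k : J} (a : i ⟶ j) (b : j ⟶ k) (x : 𝒯.obj) :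
    (Q.totIso (a ≫ b) x).hom = (Q.totIso a x).hom ≫ (Q.totIso b x).hom := by
  obtain ⟨h, e⟩ := Q.compat_comp a b x
  refine (congrArg SecHom.tot e).trans ?_
  refine (congr($(SecObj.eqToHom_tot h) ≫ _)).trans ?_
  exact Category.id_comp _

theorem baseIso_hom_comp {i j k : J} (a : i ⟶ j) (b : j ⟶ k) (x : 𝒯.obj) :
    (Q.baseIso (a ≫ b) x).hom = (Q.baseIso a x).hom ≫ (Q.baseIso b x).hom := by
  obtain ⟨h, e⟩ := Q.compat_comp a b x
  refine (congrArg SecHom.base e).trans ?_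
  refine (congr($(SecObj.eqToHom_base h) ≫ _)).trans ?_
  exact Category.id_comp _

theorem totIso_hom_s {i j : J} (a : i ⟶ j) (x : 𝒯.obj) :
    (Q.totIso a x).hom ≫ (Q.sec j x).s = (Q.sec i x).s ≫ (D.map a).left :=
  (Q.compat a x).tot_s

theorem homTot_totIso_inv {i j : J} (a : i ⟶ j) {x y : 𝒯.obj} (m : x ⟶ y) :
    Q.homTot j m ≫ (Q.totIso a y).inv = (Q.totIso a x).inv ≫ Q.homTot i m :=
  congrArg SecHom.tot (Q.compatInv_naturality a m)

theorem homBase_baseIso_inv {i j : J} (a : i ⟶ j) {x y : 𝒯.obj} (m : x ⟶ y) :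
    Q.homBase j m ≫ (Q.baseIso a y).inv = (Q.baseIso a x).inv ≫ Q.homBase i m :=
  congrArg SecHom.base (Q.compatInv_naturality a m)

/-! ### Transport to the terminal index and the induced section of the limit. -/

variable {t : J} (ht : IsTerminal t)

/-- The cocycle condition applied to `i ⟶ j ⟶ t`, whose composite is the only arrow `i ⟶ t`. This is
where terminality makes the transports coherent. -/
theorem totIso_inv_comp_totIso_hom {i j : J} (a : i ⟶ j) (x : 𝒯.obj) :
    (Q.totIso (ht.from i) x).inv ≫ (Q.totIso a x).hom = (Q.totIso (ht.from j) x).inv := by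
  rw [Iso.inv_comp_eq, ht.hom_ext (ht.from i) (a ≫ ht.from j), totIso_hom_comp,
    Category.assoc, Iso.hom_inv_id, Category.comp_id]

theorem baseIso_inv_comp_baseIso_hom {i j : J} (a : i ⟶ j) (x : 𝒯.obj) :
    (Q.baseIso (ht.from i) x).inv ≫ (Q.baseIso a x).hom = (Q.baseIso (ht.from j) x).inv := by
  rw [Iso.inv_comp_eq, ht.hom_ext (ht.from i) (a ≫ ht.from j), baseIso_hom_comp,
    Category.assoc, Iso.hom_inv_id, Category.comp_id]

/-- The sections of all `D j`, transported to the base change of `X` belonging to the terminal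
index, form a cone. -/
def sectionCone (x : 𝒯.obj) : Cone (D ⋙ Over.forget X) where
  pt := (Q.sec t x).XS
  π :=
    { app j := (Q.totIso (ht.from j) x).inv ≫ (Q.sec j x).s
      naturality i j a := by
        refine (Category.id_comp _).trans ?_
        change (Q.totIso (ht.from j) x).inv ≫ (Q.sec j x).s =
          ((Q.totIso (ht.from i) x).inv ≫ (Q.sec i x).s) ≫ (D.map a).left
        rw [Category.assoc, ← totIso_hom_s, ← Category.assoc, totIso_inv_comp_totIso_hom] }

variable {c : Cone D} (hc : IsLimit ((Over.forget X).mapCone c))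

/-- The map to the limit induced by compatible sections. -/
def sectionLift (x : 𝒯.obj) : (Q.sec t x).XS ⟶ c.pt.left := hc.lift (Q.sectionCone ht x)

theorem sectionLift_π (x : 𝒯.obj) (j : J) :
    Q.sectionLift ht hc x ≫ (c.π.app j).left = (Q.totIso (ht.from j) x).inv ≫ (Q.sec j x).s :=
  hc.fac (Q.sectionCone ht x) j

theorem totIso_hom_sectionLift_π (x : 𝒯.obj) (j : J) :
    (Q.totIso (ht.from j) x).hom ≫ Q.sectionLift ht hc x ≫ (c.π.app j).left =
      (Q.sec j x).s := by
  rw [sectionLift_π, Iso.hom_inv_id_assoc]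

/-- The structure map of the limit factors through its leg at `t`, and the compatibility
isomorphisms respect the projections to `X`. -/
theorem sectionLift_hom (x : 𝒯.obj) : Q.sectionLift ht hc x ≫ c.pt.hom = (Q.sec t x).toX := by
  have h : (c.π.app t).left ≫ (D.obj t).hom = c.pt.hom := Over.w (c.π.app t)
  rw [← h, ← Category.assoc, sectionLift_π, Category.assoc, (Q.sec t x).w]
  exact (Q.compatInv (ht.from t) x).tot_toX

/-- Tested on each leg of the limit, this is naturality of the transport isomorphisms together with
the fact that arrows preserve the sections. -/
theorem homTot_sectionLift {x y : 𝒯.obj} (m : x ⟶ y) :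
    Q.homTot t m ≫ Q.sectionLift ht hc y = Q.sectionLift ht hc x := by
  refine hc.hom_ext fun j ↦ ?_
  change (_ ≫ _) ≫ (c.π.app j).left = _ ≫ (c.π.app j).left
  rw [Category.assoc, sectionLift_π, sectionLift_π, ← Category.assoc, homTot_totIso_inv,
    Category.assoc, homTot_s]

/-- The functor to the sections of the limit induced by a pseudo-cone. -/
def lift : 𝒯 ⥤ᵇ secBased f c.pt where
  obj x :=
    { S := (Q.sec t x).S
      b := (Q.sec t x).b
      XS := (Q.sec t x).XS
      toX := (Q.sec t x).toX
      toS := (Q.sec t x).toS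
      isPullback := (Q.sec t x).isPullback
      s := Q.sectionLift ht hc x
      w := Q.sectionLift_hom ht hc x }
  map m :=
    { base := Q.homBase t m
      tot := Q.homTot t m
      base_b := (Q.secHom t m).base_b
      tot_toX := (Q.secHom t m).tot_toX
      isPullback := (Q.secHom t m).isPullback
      tot_s := Q.homTot_sectionLift ht hc m }
  map_id x := SecHom.ext (Q.homBase_id t x) (Q.homTot_id t x)
  map_comp m n := SecHom.ext (Q.homBase_comp t m n) (Q.homTot_comp t m n)
  w := (Q.π t).w

/-- The section of the limit induced by a pseudo-cone projects to the given sections. -/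
def liftProjIso (j : J) (x : 𝒯.obj) :
    (secMap f (c.π.app j)).obj ((Q.lift ht hc).obj x) ≅ Q.sec j x where
  hom :=
    { base := (Q.baseIso (ht.from j) x).inv
      tot := (Q.totIso (ht.from j) x).inv
      base_b := (Q.compatInv (ht.from j) x).base_b
      tot_toX := (Q.compatInv (ht.from j) x).tot_toX
      isPullback := (Q.compatInv (ht.from j) x).isPullback
      tot_s := (Q.sectionLift_π ht hc x j).symm }
  inv :=
    { base := (Q.baseIso (ht.from j) x).hom
      tot := (Q.totIso (ht.from j) x).hom
      base_b := (Q.compat (ht.from j) x).base_b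
      tot_toX := (Q.compat (ht.from j) x).tot_toX
      isPullback := (Q.compat (ht.from j) x).isPullback
      tot_s := Q.totIso_hom_sectionLift_π ht hc x j }
  hom_inv_id := SecHom.ext (Q.baseIso (ht.from j) x).inv_hom_id (Q.totIso (ht.from j) x).inv_hom_id
  inv_hom_id := SecHom.ext (Q.baseIso (ht.from j) x).hom_inv_id (Q.totIso (ht.from j) x).hom_inv_id

/-- Being a lift depends only on the map of bases, and that map is shared with `compatInv (ht.from
j) x`, although the two arrows lie in sections of different objects. -/
theorem isHomLift_liftProjIso_hom (j : J) (x : 𝒯.obj) :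
    (secBased f (D.obj j)).p.IsHomLift (𝟙 (𝒯.p.obj x)) (Q.liftProjIso ht hc j x).hom := by
  have h : (secBased f (D.obj t)).p.IsHomLift (𝟙 (𝒯.p.obj x)) (Q.compatInv (ht.from j) x) :=
    (Q.θ (ht.from j)).inv.isHomLift' x
  exact IsHomLift.of_fac' _ _ _ 
    (IsHomLift.domain_eq (secBased f (D.obj t)).p (𝟙 (𝒯.p.obj x)) (Q.compatInv (ht.from j) x))
    (IsHomLift.codomain_eq (secBased f (D.obj t)).p (𝟙 (𝒯.p.obj x)) (Q.compatInv (ht.from j) x))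
    (IsHomLift.fac' (secBased f (D.obj t)).p (𝟙 (𝒯.p.obj x)) (Q.compatInv (ht.from j) x))

/-- The functor induced by a pseudo-cone composes with the projections to the given functors. -/
def liftCompIso (j : J) : BasedFunctor.comp (Q.lift ht hc) (secMap f (c.π.app j)) ≅ Q.π j :=
  BasedNatIso.mkNatIso
    (NatIso.ofComponents (fun x ↦ Q.liftProjIso ht hc j x) (fun m ↦
      SecHom.ext (Q.homBase_baseIso_inv (ht.from j) m) (Q.homTot_totIso_inv (ht.from j) m)))
    (Q.isHomLift_liftProjIso_hom ht hc j)

/-! ### The strict cone of the limit, compared with a given pseudo-cone. -/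

theorem compApp_ofCone_θ_hom {F : J ⥤ BasedCategory.{v₂, u₂} C} (c : Cone F) {i j : J} (a : i ⟶ j)
    (x : c.pt.obj) :
    compApp ((ofCone c).θ a).hom x = eqToHom congr(($(c.w a)).obj x) :=
  eqToHom_app (c.w a) x

/-- The two ways of projecting a section of the limit differ only in how the section is written; the
base change is literally the same, so the transport acts on it as the identity. -/
theorem compApp_ofCone_secFunctor_θ_tot (c : Cone D) {i j : J} (a : i ⟶ j) (x : SecObj f c.pt) :
    SecHom.tot (Z := D.obj j) (x := (secMap f (D.map a)).obj ((secMap f (c.π.app i)).obj x))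
      (y := (secMap f (c.π.app j)).obj x)
      (compApp ((ofCone ((secFunctor f).mapCone c)).θ a).hom x) = 𝟙 x.XS :=
  (congrArg SecHom.tot (compApp_ofCone_θ_hom ((secFunctor f).mapCone c) a x)).trans
    (SecObj.eqToHom_tot _)

theorem compApp_ofCone_secFunctor_θ_base (c : Cone D) {i j : J} (a : i ⟶ j) (x : SecObj f c.pt) :
    SecHom.base (Z := D.obj j) (x := (secMap f (D.map a)).obj ((secMap f (c.π.app i)).obj x))
      (y := (secMap f (c.π.app j)).obj x)
      (compApp ((ofCone ((secFunctor f).mapCone c)).θ a).hom x) = 𝟙 x.S :=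
  (congrArg SecHom.base (compApp_ofCone_θ_hom ((secFunctor f).mapCone c) a x)).trans
    (SecObj.eqToHom_base _)

/-- The pseudo-cone induced by the functor to the sections of the limit. -/
def comparisonLiftIso :
    ((ofCone ((secFunctor f).mapCone c)).comparison 𝒯).obj (Q.lift ht hc) ≅ Q :=
  isoMk (Q.liftCompIso ht hc) (fun {i j} a x ↦ by
    refine SecHom.ext ?_ ?_
    -- The strict cone contributes an identity, so compatibility reduces to the triangle over `t`.
    · refine (Q.baseIso_inv_comp_baseIso_hom ht a x).trans ((Category.id_comp _).symm.trans ?_)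
      exact congr($((compApp_ofCone_secFunctor_θ_base c a ((Q.lift ht hc).obj x)).symm) ≫
        (Q.baseIso (ht.from j) x).inv)
    · refine (Q.totIso_inv_comp_totIso_hom ht a x).trans ((Category.id_comp _).symm.trans ?_)
      exact congr($((compApp_ofCone_secFunctor_θ_tot c a ((Q.lift ht hc).obj x)).symm) ≫
        (Q.totIso (ht.from j) x).inv))

/-! ### Full faithfulness of the comparison functor. -/

variable {G G' : 𝒯 ⥤ᵇ secBased f c.pt}
  (μ : ((ofCone ((secFunctor f).mapCone c)).comparison 𝒯).obj G ⟶
    ((ofCone ((secFunctor f).mapCone c)).comparison 𝒯).obj G')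

/-- The component of a morphism of pseudo-cones, as an arrow of sections. -/
def compSecHom (j : J) (x : 𝒯.obj) :
    (secMap f (c.π.app j)).obj (G.obj x) ⟶ (secMap f (c.π.app j)).obj (G'.obj x) :=
  (Hom.app μ j).app x

/-- The component of a morphism of pseudo-cones, on the base changes of `X`. -/
def compTot (j : J) (x : 𝒯.obj) : SecObj.XS (G.obj x) ⟶ SecObj.XS (G'.obj x) :=
  SecHom.tot (x := (secMap f (c.π.app j)).obj (G.obj x))
    (y := (secMap f (c.π.app j)).obj (G'.obj x)) (compSecHom μ j x)

/-- The component of a morphism of pseudo-cones, on the bases. -/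
def compBase (j : J) (x : 𝒯.obj) : SecObj.S (G.obj x) ⟶ SecObj.S (G'.obj x) :=
  SecHom.base (x := (secMap f (c.π.app j)).obj (G.obj x))
    (y := (secMap f (c.π.app j)).obj (G'.obj x)) (compSecHom μ j x)

theorem isHomLift_compSecHom (j : J) (x : 𝒯.obj) :
    (secBased f (D.obj j)).p.IsHomLift (𝟙 (𝒯.p.obj x)) (compSecHom μ j x) :=
  (Hom.app μ j).isHomLift' x

/-- In the compatibility square for `a`, both isomorphisms come from the strict cone and are
identities on base changes; what remains is this equality. -/
theorem compTot_eq {i j : J} (a : i ⟶ j) (x : 𝒯.obj) : compTot μ i x = compTot μ j x := by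
  have h := congrArg SecHom.tot (Hom.comm μ a x)
  have h₁ := compApp_ofCone_secFunctor_θ_tot c a (G.obj x)
  have h₂ := compApp_ofCone_secFunctor_θ_tot c a (G'.obj x)
  refine (Category.comp_id _).symm.trans (Eq.trans ?_ (Category.id_comp _))
  exact (congr(compTot μ i x ≫ $(h₂.symm))).trans (h.trans congr($h₁ ≫ compTot μ j x))

/-- On the leg at `j`, the component at `t` may be replaced by the one at `j`, which preserves the
projected section by definition. The legs of the limit are jointly monic. -/
theorem compTot_s (ht : IsTerminal t) (hc : IsLimit ((Over.forget X).mapCone c)) (x : 𝒯.obj) :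
    compTot μ t x ≫ SecObj.s (G'.obj x) = SecObj.s (G.obj x) := by
  refine hc.hom_ext fun j ↦ ?_
  change (_ ≫ _) ≫ (c.π.app j).left = _ ≫ (c.π.app j).left
  rw [← compTot_eq μ (ht.from j), Category.assoc]
  exact (compSecHom μ j x).tot_s

/-- The natural transformation induced by a morphism of pseudo-cones. -/
def preimage : G ⟶ G' where
  app x :=
    { base := compBase μ t x
      tot := compTot μ t x
      base_b := (compSecHom μ t x).base_b
      tot_toX := (compSecHom μ t x).tot_toX
      isPullback := (compSecHom μ t x).isPullback
      tot_s := compTot_s μ ht hc x }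
  naturality x y m := by
    have h : (secMap f (c.π.app t)).map (G.map m) ≫ compSecHom μ t y =
      compSecHom μ t x ≫ (secMap f (c.π.app t)).map (G'.map m) := (Hom.app μ t).naturality m
    have h₁ := congrArg SecHom.base h
    have h₂ := congrArg SecHom.tot h
    exact SecHom.ext h₁ h₂
  isHomLift' x := by
    have h := isHomLift_compSecHom μ t x
    exact IsHomLift.of_fac' _ _ _
      (IsHomLift.domain_eq (secBased f (D.obj t)).p (𝟙 (𝒯.p.obj x)) (compSecHom μ t x))
      (IsHomLift.codomain_eq (secBased f (D.obj t)).p (𝟙 (𝒯.p.obj x)) (compSecHom μ t x))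
      (IsHomLift.fac' (secBased f (D.obj t)).p (𝟙 (𝒯.p.obj x)) (compSecHom μ t x))

theorem comparison_map_preimage :
    ((ofCone ((secFunctor f).mapCone c)).comparison 𝒯).map (preimage ht hc μ) = μ := by
  refine Hom.ext (funext fun j ↦ ?_)
  ext x
  -- Both sides lift the same identity, so only the maps of base changes matter; the preimage was
  -- built from index `t`, and the components at `t` and `j` agree.
  refine SecObj.hom_ext_of_isHomLift (𝟙 (𝒯.p.obj x)) ?_ (isHomLift_compSecHom μ j x)
    (compTot_eq μ (ht.from j) x).symm
  exact isHomLift_compSecHom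
    (((ofCone ((secFunctor f).mapCone c)).comparison 𝒯).map (preimage ht hc μ)) j x

end PseudoCone

/-- The functor of sections sends limits of diagrams indexed by a category with a terminal object
to limits in the 2-category of categories over the base category. -/
theorem isTwoLimit_secFunctor {t : J} (ht : IsTerminal t) {c : Cone D}
    (hc : IsLimit ((Over.forget X).mapCone c)) :
    PseudoCone.IsTwoLimit.{v, w, v₁, u₁, v₁, max u₁ v₁, v₃, u₃, v₁, max u₁ v₁}
      (PseudoCone.ofCone ((secFunctor f).mapCone c)) := fun 𝒯 ↦
  { faithful := ⟨fun {G G'} m n h ↦ by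
      ext x
      exact SecObj.hom_ext_of_isHomLift (𝟙 (𝒯.p.obj x)) (m.isHomLift' x) (n.isHomLift' x)
        congr(PseudoCone.compTot $h t x)⟩
    full := ⟨fun μ ↦ ⟨_, PseudoCone.comparison_map_preimage ht hc μ⟩⟩
    essSurj := ⟨fun Q ↦ ⟨_, ⟨Q.comparisonLiftIso ht hc⟩⟩⟩ }

end TwoLimitOfSections

theorem theorem2p2 {J : Type w} [Category.{v} J] {X B : FsLogScheme.{u}} (f : X ⟶ B)
    -- a diagram of fs log schemes over `X` with final object `X`
    (D : J ⥤ Over X) {t : J} (ht : IsTerminal t) (hX : IsIso (D.obj t).hom)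
    -- its limit in the category of fs log schemes
    (c : Cone D) (hc : IsLimit ((Over.forget X).mapCone c)) :
    -- `Sec_{X/B}(c.pt/X)` is the limit of the `Sec_{X/B}(D j/X)` over fs log schemes
    (PseudoCone.ofCone ((secFunctor f).mapCone c)).IsTwoLimit ∧
    -- the objects of `Sec_{X/B}(Z/X)` over `S → B` are the sections of `Z_S → X_S`
    (∀ (Z : Over X) (S XS ZS : FsLogScheme.{u}) (b : S ⟶ B) (p : XS ⟶ X) (πX : XS ⟶ S)
      (q : ZS ⟶ Z.left) (πZ : ZS ⟶ S) (r : ZS ⟶ XS) (h : IsPullback p πX f b)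
      (_ : IsPullback q πZ (Z.hom ≫ f) b) (hp : q ≫ Z.hom = r ≫ p) (_ : r ≫ πX = πZ),
      (sectionsToFiber f Z b h q r hp).IsEquivalence) ∧
    -- every arrow of `Sec_{X/B}(Z/X)` is cartesian, and an object over `S → B` has a pullback along
    -- `S' → S` if and only if the base change of `X` along `S' → B` exists
    (∀ Z : Over X, (∀ (x y : SecObj f Z) (m : x ⟶ y),
        (secBased f Z).p.IsStronglyCartesian m.base m) ∧
      ∀ (x : SecObj f Z) (S' : FsLogScheme.{u}) (φ : S' ⟶ x.S),
        HasPullback f (φ ≫ x.b) ↔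
          ∃ (y : SecObj f Z) (m : y ⟶ x), (secBased f Z).p.IsStronglyCartesian φ m) :=
  ⟨isTwoLimit_secFunctor ht hc,
    fun Z _ _ _ b _ _ _ _ _ h hZ hp hr ↦ isEquivalence_sectionsToFiber Z b h hZ hp hr,
    fun _ ↦ ⟨fun _ _ m ↦ SecObj.isStronglyCartesian m,
      fun x _ φ ↦ SecObj.hasPullback_iff_exists_isStronglyCartesian x φ⟩⟩
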